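/- Let $(\mathsf C,\otimes,K)$ be a (small) autonomous monoidal category, that is, a monoidal category in which every object has a left and a right dual. Let $t$ be a Hopf comonad on $\mathsf C$: a comonad $(t,\delta,\varepsilon)$ whose functor $t$ carries a lax monoidal structure $t_2:t(X)\otimes t(Y)\to t(X\otimes Y)$, $t_0:K\to t(K)$ such that $\delta$ and $\varepsilon$ are monoidal natural transformations, and whose fusion operators $$t(X)\otimes t(Y)\xrightarrow{1\otimes\delta_Y}t(X)\otimes tt(Y)\xrightarrow{t_2}t(X\otimes t(Y)),\qquad t(X)\otimes t(Y)\xrightarrow{\delta_X\otimes 1}tt(X)\otimes t(Y)\xrightarrow{t_2}t(t(X)\otimes Y)$$ are isomorphisms for all objects $X,Y$. Call a comonoid $(a,\delta,\varepsilon)$ in a monoidal category coseparable if there is a morphism $\nabla:a\circ a\to a$ with $\nabla\delta=1$ and (up to associativity) $(1\circ\nabla)(\delta\circ 1)=\delta\nabla=(\nabla\circ 1)(1\circ\delta)$. Let $\mathsf{cat}(\mathsf C,\mathsf C)$ be the category of endofunctors of $\mathsf C$, with composition as monoidal product. Let $\mathsf{prof}(\mathsf C,\mathsf C)$ be the category of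 functors $\mathsf C^{\mathsf{op}}\times\mathsf C\to\mathsf{set}$ (profunctors), with monoidal product $(P\circ Q)(c,a)=\int^{b}P(b,a)\times Q(c,b)$ and monoidal unit $i=\mathsf C(-,-)$; the comonad $t$ gives rise to the comonoid $\mathsf C(-,t(-))$ in it. Then the following assertions are equivalent. (i') $(t,\delta,\varepsilon)$ is a coseparable comonoid in $\mathsf{cat}(\mathsf C,\mathsf C)$. (i) $(t,\delta,\varepsilon)$, regarded as the comonoid $\mathsf C(-,t(-))$, is coseparable in $(\mathsf{prof}(\mathsf C,\mathsf C),\circ,i)$. (ii) There is a normalized left cointegral, that is, a morphism $\Lambda:t(K)\to K$ such that $t(\Lambda)\,\delta_K=t_0\,\Lambda$ and $\Lambda\,t_0=1_K$. (iii) There is a normalized right cointegral, that is, a natural transformation $\tau:\mathsf C(K,t(-))\to\mathsf C(K,-)$ such that, for every object $x$, $\tau_x(t(f)\,t_0)=f$ for all $f:K\to x$, and $\tau_{t(x)}(\delta_x\,f)=t(\tau_x(f))\,t_0$ for all $f:K\to t(x)$. -/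

import Mathlib

open CategoryTheory MonoidalCategory Opposite
open scoped ComonObj

universe u v

namespace HopfMaschke

/-- A comonoid `a` in a monoidal category is coseparable if its comultiplication admits a
retraction `π : a ⊗ a ⟶ a` which is a morphism of left and of right `a`-comodules. -/
def IsCoseparable {D : Type u} [Category.{v} D] [MonoidalCategory D] (a : D) [ComonObj a] : Prop :=
  ∃ π : a ⊗ a ⟶ a,
    Δ[a] ≫ π = 𝟙 a ∧
    π ≫ Δ[a] = Δ[a] ▷ a ≫ (α_ a a a).hom ≫ a ◁ π ∧
    π ≫ Δ[a] = a ◁ Δ[a] ≫ (α_ a a a).inv ≫ π ▷ a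

section Endofunctors

variable {C : Type u} [Category.{v} C]

attribute [local instance] endofunctorMonoidalCategory

/-- A comonad is a comonoid in the category of endofunctors, whose monoidal structure is the
composition of functors. -/
@[reducible]
def comonadComonObj (t : Comonad C) : ComonObj (C := C ⥤ C) t.toFunctor where
  counit := t.ε
  comul := t.δ
  counit_comul := by ext X; exact t.right_counit X
  comul_counit := by ext X; exact t.left_counit X
  comul_assoc := by
    ext X
    simp [t.coassoc X]

/-- Coseparability of a comonad `t` on `C`, as a comonoid in the category of endofunctors of `C`
with the composition of functors as monoidal product. -/
def IsCoseparableInCat (t : Comonad C) : Prop :=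
  letI := comonadComonObj t
  IsCoseparable (D := C ⥤ C) t.toFunctor

end Endofunctors

/-! ### The monoidal category of endoprofunctors -/

section Profunctors

variable (C : Type u) [SmallCategory C]

/-- The category `prof(C, C)` of profunctors `Cᵒᵖ × C → Set` and natural transformations;
the value of `P` at `(c, a)` is `(P.obj a).obj (op c)`. -/
def EndoProf : Type (u + 1) := Profunctor.{u} C C

instance : Category (EndoProf C) := inferInstanceAs (Category (C ⥤ Cᵒᵖ ⥤ Type u))

end Profunctors

namespace EndoProf

variable {C : Type u} [SmallCategory C]

/-- The value `P(c, a)` of a profunctor. -/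
abbrev val (P : EndoProf C) (c a : C) : Type u :=
  (Functor.obj (C := C) (D := Cᵒᵖ ⥤ Type u) P a).obj (op c)

/-- The action `P(c, a) → P(c', a)` of a morphism `c' ⟶ c`. -/
def pre (P : EndoProf C) {c c' a : C} (g : c' ⟶ c) (p : P.val c a) : P.val c' a :=
  (Functor.obj (C := C) (D := Cᵒᵖ ⥤ Type u) P a).map g.op p

/-- The action `P(c, a) → P(c, a')` of a morphism `a ⟶ a'`. -/
def post (P : EndoProf C) {c a a' : C} (f : a ⟶ a') (p : P.val c a) : P.val c a' :=
  (CategoryTheory.Functor.map (C := C) (D := Cᵒᵖ ⥤ Type u) P f).app (op c) p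

@[simp]
theorem pre_id (P : EndoProf C) {c a : C} (p : P.val c a) : P.pre (𝟙 c) p = p := by
  simp [pre]

@[simp]
theorem post_id (P : EndoProf C) {c a : C} (p : P.val c a) : P.post (𝟙 a) p = p := by
  unfold post
  erw [CategoryTheory.Functor.map_id]
  rfl

theorem pre_comp (P : EndoProf C) {c c' c'' a : C} (g : c' ⟶ c) (g' : c'' ⟶ c')
    (p : P.val c a) : P.pre (g' ≫ g) p = P.pre g' (P.pre g p) := by
  simp [pre]

theorem post_comp (P : EndoProf C) {c a a' a'' : C} (f : a ⟶ a') (f' : a' ⟶ a'')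
    (p : P.val c a) : P.post (f ≫ f') p = P.post f' (P.post f p) := by
  unfold post
  erw [CategoryTheory.Functor.map_comp]
  rfl

theorem post_pre (P : EndoProf C) {c c' a a' : C} (f : a ⟶ a') (g : c' ⟶ c) (p : P.val c a) :
    P.post f (P.pre g p) = P.pre g (P.post f p) :=
  NatTrans.naturality_apply (C := Cᵒᵖ) (CategoryTheory.Functor.map (C := C) (D := Cᵒᵖ ⥤ Type u) P f) g.op p

/-- A profunctor from its values and the two compatible actions. -/
def mk' (F : C → C → Type u)
    (pre : ∀ {c c' a : C}, (c' ⟶ c) → F c a → F c' a)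
    (post : ∀ {c a a' : C}, (a ⟶ a') → F c a → F c a')
    (pre_id : ∀ {c a : C} (p : F c a), pre (𝟙 c) p = p)
    (post_id : ∀ {c a : C} (p : F c a), post (𝟙 a) p = p)
    (pre_comp : ∀ {c c' c'' a : C} (g : c' ⟶ c) (g' : c'' ⟶ c') (p : F c a),
      pre (g' ≫ g) p = pre g' (pre g p))
    (post_comp : ∀ {c a a' a'' : C} (f : a ⟶ a') (f' : a' ⟶ a'') (p : F c a),
      post (f ≫ f') p = post f' (post f p))
    (post_pre : ∀ {c c' a a' : C} (f : a ⟶ a') (g : c' ⟶ c) (p : F c a),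
      post f (pre g p) = pre g (post f p)) : EndoProf C :=
  show C ⥤ Cᵒᵖ ⥤ Type u from
  { obj a :=
      { obj c := F c.unop a
        map g := ↾(fun p => pre g.unop p)
        map_id c := by ext p; exact pre_id p
        map_comp g g' := by ext p; exact pre_comp g.unop g'.unop p }
    map f :=
      { app c := ↾(fun p => post f p)
        naturality c c' g := by ext p; exact post_pre f g.unop p }
    map_id a := by ext c p; exact post_id p
    map_comp f f' := by ext c p; exact post_comp f f' p }

/-- The component of a morphism of profunctors. -/
def ev {P Q : EndoProf C} (φ : P ⟶ Q) {c a : C} (p : P.val c a) : Q.val c a :=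
  NatTrans.app (C := Cᵒᵖ)
    (NatTrans.app (C := C) (D := Cᵒᵖ ⥤ Type u) (F := P) (G := Q) φ a) (op c) p

theorem ev_pre {P Q : EndoProf C} (φ : P ⟶ Q) {c c' a : C} (g : c' ⟶ c) (p : P.val c a) :
    ev φ (P.pre g p) = Q.pre g (ev φ p) :=
  NatTrans.naturality_apply (C := Cᵒᵖ)
    (NatTrans.app (C := C) (D := Cᵒᵖ ⥤ Type u) (F := P) (G := Q) φ a) g.op p

theorem ev_post {P Q : EndoProf C} (φ : P ⟶ Q) {c a a' : C} (f : a ⟶ a') (p : P.val c a) :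
    ev φ (P.post f p) = Q.post f (ev φ p) :=
  congrArg (fun ψ : Functor.obj (C := C) (D := Cᵒᵖ ⥤ Type u) P a ⟶
      Functor.obj (C := C) (D := Cᵒᵖ ⥤ Type u) Q a' => ψ.app (op c) p)
    (NatTrans.naturality (C := C) (D := Cᵒᵖ ⥤ Type u) (F := P) (G := Q) φ f)

@[ext]
theorem hom_ext {P Q : EndoProf C} {φ ψ : P ⟶ Q}
    (h : ∀ (c a : C) (p : P.val c a), ev φ p = ev ψ p) : φ = ψ := by
  refine NatTrans.ext (C := C) (D := Cᵒᵖ ⥤ Type u) (funext fun a => ?_)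
  ext c p
  exact h c.unop a p

@[simp]
theorem ev_id (P : EndoProf C) {c a : C} (p : P.val c a) : ev (𝟙 P) p = p := rfl

@[simp]
theorem ev_comp {P Q R : EndoProf C} (φ : P ⟶ Q) (ψ : Q ⟶ R) {c a : C} (p : P.val c a) :
    ev (φ ≫ ψ) p = ev ψ (ev φ p) := rfl

/-- A morphism of profunctors from its components. -/
def mkHom {P Q : EndoProf C} (φ : ∀ {c a : C}, P.val c a → Q.val c a)
    (h_pre : ∀ {c c' a : C} (g : c' ⟶ c) (p : P.val c a), φ (P.pre g p) = Q.pre g (φ p))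
    (h_post : ∀ {c a a' : C} (f : a ⟶ a') (p : P.val c a), φ (P.post f p) = Q.post f (φ p)) :
    P ⟶ Q :=
  show NatTrans (C := C) (D := Cᵒᵖ ⥤ Type u) P Q from
  { app a :=
      { app c := ↾(fun p => φ (c := c.unop) (a := a) p)
        naturality c c' g := by ext p; exact h_pre g.unop p }
    naturality a a' f := by ext c p; exact h_post f p }

@[simp]
theorem ev_mkHom {P Q : EndoProf C} (φ : ∀ {c a : C}, P.val c a → Q.val c a) (h_pre) (h_post)
    {c a : C} (p : P.val c a) :
    ev (mkHom (P := P) (Q := Q) φ h_pre h_post) p = φ p := rfl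

/-- The bifunctor `(b', b) ↦ P(b', a) × Q(c, b)`, whose coend is the value at `(c, a)` of the
composite of `P` and `Q`. -/
def kernel (P Q : EndoProf C) (c a : C) : Cᵒᵖ ⥤ C ⥤ Type u where
  obj b' :=
    { obj b := P.val b'.unop a × Q.val c b
      map f := ↾(fun x => (x.1, Q.post f x.2))
      map_id b := by ext x <;> simp
      map_comp f f' := by ext x <;> simp [post_comp] }
  map g :=
    { app b := ↾(fun x => (P.pre g.unop x.1, x.2))
      naturality b b' f := by ext x <;> rfl }
  map_id b := by ext b' x <;> simp
  map_comp f f' := by ext b' x <;> simp [pre_comp]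

/-- The set `∫^b P(b, a) × Q(c, b)`. -/
def Coend (P Q : EndoProf C) (c a : C) : Type u := Limits.Types.coend.{u} (kernel P Q c a)

/-- The class of `(p, q) ∈ P(b, a) × Q(c, b)` in the coend. -/
def tmk (P Q : EndoProf C) {c a : C} (b : C) (p : P.val b a) (q : Q.val c b) : Coend P Q c a :=
  Quot.mk _ ⟨b, (p, q)⟩

theorem tmk_sound (P Q : EndoProf C) {c a b b' : C} (f : b ⟶ b') (p : P.val b' a)
    (q : Q.val c b) : tmk P Q b (P.pre f p) q = tmk P Q b' p (Q.post f q) :=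
  Quot.sound (Limits.Types.coendRel.mk (F := kernel P Q c a) f (p, q))

theorem tmk_ind {P Q : EndoProf C} {c a : C} {motive : Coend P Q c a → Prop}
    (h : ∀ (b : C) (p : P.val b a) (q : Q.val c b), motive (tmk P Q b p q)) (x) : motive x :=
  Quot.ind (fun y => h y.1 y.2.1 y.2.2) x

/-- A map out of the coend. -/
def tlift (P Q : EndoProf C) {c a : C} {X : Type u} (φ : ∀ b : C, P.val b a → Q.val c b → X)
    (h : ∀ {b b' : C} (f : b ⟶ b') (p : P.val b' a) (q : Q.val c b),
      φ b (P.pre f p) q = φ b' p (Q.post f q)) : Coend P Q c a → X :=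
  Quot.lift (fun y => φ y.1 y.2.1 y.2.2) (by rintro _ _ ⟨f, x⟩; exact h f x.1 x.2)

@[simp]
theorem tlift_tmk (P Q : EndoProf C) {c a : C} {X : Type u}
    (φ : ∀ b : C, P.val b a → Q.val c b → X) (h) (b : C) (p : P.val b a) (q : Q.val c b) :
    tlift P Q φ h (tmk P Q b p q) = φ b p q := rfl

/-- The composition product `P ∘ Q` of profunctors, that is, the composite `C ⟶ C ⟶ C` in which
`P` comes first: its value at `(c, a)` is `∫^b P(b, a) × Q(c, b)`. -/
def comp (P Q : EndoProf C) : EndoProf C :=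
  mk' (Coend P Q)
    (fun g => tlift P Q (fun b p q => tmk P Q b p (Q.pre g q))
      (fun f p q => by rw [tmk_sound, post_pre]))
    (fun f => tlift P Q (fun b p q => tmk P Q b (P.post f p) q)
      (fun f p q => by rw [post_pre, tmk_sound]))
    (tmk_ind fun b p q => by simp)
    (tmk_ind fun b p q => by simp)
    (fun g g' => tmk_ind fun b p q => by simp [pre_comp])
    (fun f f' => tmk_ind fun b p q => by simp [post_comp])
    (fun f g => tmk_ind fun b p q => by simp)

/-- The class of `(p, q) ∈ P(b, a) × Q(c, b)` in `(P ∘ Q)(c, a)`. -/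
def tpair {P Q : EndoProf C} {c a : C} (b : C) (p : P.val b a) (q : Q.val c b) :
    (comp P Q).val c a :=
  tmk P Q b p q

theorem tpair_sound {P Q : EndoProf C} {c a b b' : C} (f : b ⟶ b') (p : P.val b' a)
    (q : Q.val c b) : tpair (P := P) (Q := Q) b (P.pre f p) q = tpair b' p (Q.post f q) :=
  tmk_sound P Q f p q

theorem tpair_ind {P Q : EndoProf C} {c a : C} {motive : (comp P Q).val c a → Prop}
    (h : ∀ (b : C) (p : P.val b a) (q : Q.val c b), motive (tpair b p q)) (x) : motive x :=
  tmk_ind h x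

@[simp]
theorem pre_tpair {P Q : EndoProf C} {c c' a b : C} (g : c' ⟶ c) (p : P.val b a)
    (q : Q.val c b) : (comp P Q).pre g (tpair b p q) = tpair b p (Q.pre g q) := rfl

@[simp]
theorem post_tpair {P Q : EndoProf C} {c a a' b : C} (f : a ⟶ a') (p : P.val b a)
    (q : Q.val c b) : (comp P Q).post f (tpair b p q) = tpair b (P.post f p) q := rfl

/-- A morphism out of a composition product. -/
def liftHom {P Q R : EndoProf C} (φ : ∀ {c a : C} (b : C), P.val b a → Q.val c b → R.val c a)
    (h : ∀ {c a b b' : C} (f : b ⟶ b') (p : P.val b' a) (q : Q.val c b),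
      φ b (P.pre f p) q = φ b' p (Q.post f q))
    (h_pre : ∀ {c c' a b : C} (g : c' ⟶ c) (p : P.val b a) (q : Q.val c b),
      φ b p (Q.pre g q) = R.pre g (φ b p q))
    (h_post : ∀ {c a a' b : C} (f : a ⟶ a') (p : P.val b a) (q : Q.val c b),
      φ b (P.post f p) q = R.post f (φ b p q)) : comp P Q ⟶ R :=
  mkHom (fun {_ _} => tlift P Q φ h)
    (fun g => tpair_ind fun _ p q => h_pre g p q)
    (fun f => tpair_ind fun _ p q => h_post f p q)

@[simp]
theorem ev_liftHom {P Q R : EndoProf C}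
    (φ : ∀ {c a : C} (b : C), P.val b a → Q.val c b → R.val c a) (h) (h_pre) (h_post)
    {c a b : C} (p : P.val b a) (q : Q.val c b) :
    ev (liftHom (R := R) φ h h_pre h_post) (tpair b p q) = φ b p q := rfl

theorem comp_hom_ext {P Q R : EndoProf C} {φ ψ : comp P Q ⟶ R}
    (h : ∀ (c a b : C) (p : P.val b a) (q : Q.val c b),
      ev φ (tpair b p q) = ev ψ (tpair b p q)) : φ = ψ := by
  ext c a x
  exact tpair_ind (motive := fun x => ev φ x = ev ψ x) (fun b p q => h c a b p q) x

/-- Horizontal composition of morphisms of profunctors. -/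
def compMap {P P' Q Q' : EndoProf C} (φ : P ⟶ P') (ψ : Q ⟶ Q') : comp P Q ⟶ comp P' Q' :=
  liftHom (fun b p q => tpair b (ev φ p) (ev ψ q))
    (fun f p q => by rw [ev_pre, ev_post, tpair_sound])
    (fun g p q => by rw [ev_pre, pre_tpair])
    (fun f p q => by rw [ev_post, post_tpair])

@[simp]
theorem ev_compMap {P P' Q Q' : EndoProf C} (φ : P ⟶ P') (ψ : Q ⟶ Q') {c a b : C}
    (p : P.val b a) (q : Q.val c b) :
    ev (compMap φ ψ) (tpair b p q) = tpair b (ev φ p) (ev ψ q) := rfl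

/-- The profunctor `C(-, f -)` of a functor `f`. -/
def ofFunctor (f : C ⥤ C) : EndoProf C := f.toProfunctor

@[simp]
theorem pre_ofFunctor (f : C ⥤ C) {c c' a : C} (g : c' ⟶ c) (h : c ⟶ f.obj a) :
    (ofFunctor f).pre g h = g ≫ h := rfl

@[simp]
theorem post_ofFunctor (f : C ⥤ C) {c a a' : C} (g : a ⟶ a') (h : c ⟶ f.obj a) :
    (ofFunctor f).post g h = h ≫ f.map g := by
  simp [post, ofFunctor]
  rfl

/-- The identity profunctor `i = C(-, -)`. -/
def unit (C : Type u) [SmallCategory C] : EndoProf C := ofFunctor (𝟭 C)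

/-- The associativity isomorphism `[[p, q], r] ↦ [p, [q, r]]`. -/
def assoc (P Q R : EndoProf C) : comp (comp P Q) R ≅ comp P (comp Q R) where
  hom := liftHom
    (fun {c a} b x r => tlift P Q
      (fun b' p q => (tpair b' p (tpair b q r : (comp Q R).val c b') : (comp P (comp Q R)).val c a))
      (fun f p q => tpair_sound (P := P) (Q := comp Q R) f p (tpair b q r)) x)
    (fun f x r => by
      induction x using tpair_ind with | _ b' p q
      exact congrArg (tpair (Q := comp Q R) b' p) (tpair_sound f q r))
    (fun _ x _ => tpair_ind (motive := fun x => tlift P Q _ _ x =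
      (comp P (comp Q R)).pre _ (tlift P Q _ _ x)) (fun _ _ _ => rfl) x)
    (fun f x _ => tpair_ind (motive := fun x => tlift P Q _ _ ((comp P Q).post f x) =
      (comp P (comp Q R)).post f (tlift P Q _ _ x)) (fun _ _ _ => rfl) x)
  inv := liftHom
    (fun {c a} b p x => tlift Q R
      (fun b' q r => (tpair b' (tpair b p q : (comp P Q).val b' a) r : (comp (comp P Q) R).val c a))
      (fun f q r => tpair_sound (P := comp P Q) (Q := R) f (tpair b p q) r) x)
    (fun f p x => by
      induction x using tpair_ind with | _ b' q r
      exact congrArg (fun y => tpair (P := comp P Q) b' y r) (tpair_sound f p q))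
    (fun g _ x => tpair_ind (motive := fun x => tlift Q R _ _ ((comp Q R).pre g x) =
      (comp (comp P Q) R).pre g (tlift Q R _ _ x)) (fun _ _ _ => rfl) x)
    (fun _ _ x => tpair_ind (motive := fun x => tlift Q R _ _ x =
      (comp (comp P Q) R).post _ (tlift Q R _ _ x)) (fun _ _ _ => rfl) x)
  hom_inv_id := by
    apply comp_hom_ext
    intro c a b x r
    induction x using tpair_ind
    rfl
  inv_hom_id := by
    apply comp_hom_ext
    intro c a b p x
    induction x using tpair_ind
    rfl

@[simp]
theorem ev_assoc_hom {P Q R : EndoProf C} {c a b b' : C} (p : P.val b' a) (q : Q.val b b')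
    (r : R.val c b) : ev (assoc P Q R).hom (tpair b (tpair b' p q : (comp P Q).val b a) r) =
      tpair b' p (tpair b q r : (comp Q R).val c b') := rfl

@[simp]
theorem ev_assoc_inv {P Q R : EndoProf C} {c a b b' : C} (p : P.val b' a) (q : Q.val b b')
    (r : R.val c b) : ev (assoc P Q R).inv (tpair b' p (tpair b q r : (comp Q R).val c b')) =
      tpair b (tpair b' p q : (comp P Q).val b a) r := rfl

/-- The left unit isomorphism `[f, p] ↦ f • p`. -/
def leftUnit (P : EndoProf C) : comp (unit C) P ≅ P where
  hom := liftHom (fun {_ a} b (f : b ⟶ a) p => P.post f p)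
    (fun f g p => P.post_comp f g p)
    (fun g f p => P.post_pre f g p)
    (fun {_ _ _ _} g f p => (congrArg (fun h => P.post h p) (post_ofFunctor (𝟭 C) g f)).trans
      (P.post_comp f g p))
  inv := mkHom (fun {_ a} p => tpair a (𝟙 a : a ⟶ a) p)
    (fun _ _ => rfl)
    (fun {c a a'} f p => by
      refine (tpair_sound (P := unit C) f (𝟙 a' : a' ⟶ a') p).symm.trans ?_
      refine congrArg (fun h => tpair (P := unit C) a h p) ?_
      refine Eq.trans ?_ (post_ofFunctor (𝟭 C) f (𝟙 a)).symm
      exact (Category.comp_id f).trans (Category.id_comp f).symm)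
  hom_inv_id := by
    apply comp_hom_ext
    intro c a b (f : b ⟶ a) p
    refine (tpair_sound (P := unit C) f (𝟙 a : a ⟶ a) p).symm.trans ?_
    exact congrArg (fun h => tpair (P := unit C) b h p) (Category.comp_id f)
  inv_hom_id := by
    ext c a p
    exact P.post_id p

@[simp]
theorem ev_leftUnit_hom {P : EndoProf C} {c a b : C} (f : b ⟶ a) (p : P.val c b) :
    ev (leftUnit P).hom (tpair (P := unit C) b f p) = P.post f p := rfl

@[simp]
theorem ev_leftUnit_inv {P : EndoProf C} {c a : C} (p : P.val c a) :
    ev (leftUnit P).inv p = tpair (P := unit C) a (𝟙 a : a ⟶ a) p := rfl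

/-- The right unit isomorphism `[p, g] ↦ p • g`. -/
def rightUnit (P : EndoProf C) : comp P (unit C) ≅ P where
  hom := liftHom (fun {c _} b p (g : c ⟶ b) => P.pre g p)
    (fun f p g => (P.pre_comp f g p).symm.trans
      (congrArg (fun h => P.pre h p) (post_ofFunctor (𝟭 C) f g).symm))
    (fun h p g => P.pre_comp g h p)
    (fun f p g => (P.post_pre f g p).symm)
  inv := mkHom (fun {c _} p => tpair c p (𝟙 c : c ⟶ c))
    (fun {c c' a} g p => by
      refine (tpair_sound (Q := unit C) g p (𝟙 c' : c' ⟶ c')).trans ?_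
      refine congrArg (fun h => tpair (Q := unit C) c p h) ?_
      refine Eq.trans (post_ofFunctor (𝟭 C) g (𝟙 c')) ?_
      exact (Category.id_comp g).trans (Category.comp_id g).symm)
    (fun _ _ => rfl)
  hom_inv_id := by
    apply comp_hom_ext
    intro c a b p (g : c ⟶ b)
    refine (tpair_sound (Q := unit C) g p (𝟙 c : c ⟶ c)).trans ?_
    refine congrArg (fun h => tpair (Q := unit C) b p h) ?_
    exact (post_ofFunctor (𝟭 C) g (𝟙 c)).trans (Category.id_comp g)
  inv_hom_id := by
    ext c a p
    exact P.pre_id p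

@[simp]
theorem ev_rightUnit_hom {P : EndoProf C} {c a b : C} (p : P.val b a) (g : c ⟶ b) :
    ev (rightUnit P).hom (tpair (Q := unit C) b p g) = P.pre g p := rfl

@[simp]
theorem ev_rightUnit_inv {P : EndoProf C} {c a : C} (p : P.val c a) :
    ev (rightUnit P).inv p = tpair (Q := unit C) c p (𝟙 c : c ⟶ c) := rfl

/-- The monoidal category `(prof(C, C), ∘, i)`. -/
instance : MonoidalCategory (EndoProf C) where
  tensorObj := comp
  whiskerLeft P _ _ ψ := compMap (𝟙 P) ψ
  whiskerRight φ Q := compMap φ (𝟙 Q)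
  tensorHom φ ψ := compMap φ ψ
  tensorUnit := unit C
  associator := assoc
  leftUnitor := leftUnit
  rightUnitor := rightUnit
  tensorHom_def _ _ := comp_hom_ext fun _ _ _ _ _ => rfl
  id_tensorHom_id _ _ := comp_hom_ext fun _ _ _ _ _ => rfl
  tensorHom_comp_tensorHom _ _ _ _ := comp_hom_ext fun _ _ _ _ _ => rfl
  whiskerLeft_id _ _ := comp_hom_ext fun _ _ _ _ _ => rfl
  id_whiskerRight _ _ := comp_hom_ext fun _ _ _ _ _ => rfl
  associator_naturality _ _ _ := comp_hom_ext fun c a b x r => by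
    induction x using tpair_ind
    rfl
  leftUnitor_naturality φ := comp_hom_ext fun _ _ _ f p => (ev_post φ f p).symm
  rightUnitor_naturality φ := comp_hom_ext fun _ _ _ p g => (ev_pre φ g p).symm
  pentagon _ _ _ _ := comp_hom_ext fun c a b x r => by
    induction x using tpair_ind with | _ b' x q
    induction x using tpair_ind
    rfl
  triangle P Q := comp_hom_ext fun c a b x q => by
    induction x using tpair_ind with | _ b' p g
    exact (tpair_sound g p q).symm

/-- The canonical bijection from `C(c, g(f(a)))` to the coend `∫^b C(b, f(a)) × C(c, g(b))`, which
sends `h` to the class of `(𝟙, h)`. -/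
def split (f g : C ⥤ C) {c a : C} (h : c ⟶ g.obj (f.obj a)) :
    (comp (ofFunctor f) (ofFunctor g)).val c a :=
  tpair (P := ofFunctor f) (Q := ofFunctor g) (f.obj a) (𝟙 (f.obj a)) h

theorem tpair_eq_split (f g : C ⥤ C) {c a b : C} (p : b ⟶ f.obj a) (q : c ⟶ g.obj b) :
    tpair (P := ofFunctor f) (Q := ofFunctor g) b p q = split f g (q ≫ g.map p) := by
  refine Eq.trans ?_ ((tpair_sound (P := ofFunctor f) (Q := ofFunctor g) p
    (𝟙 (f.obj a) : f.obj a ⟶ f.obj a) q).trans ?_)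
  · exact congrArg (fun h => tpair (P := ofFunctor f) (Q := ofFunctor g) b h q)
      (Category.comp_id p).symm
  · exact congrArg (fun h => tpair (P := ofFunctor f) (Q := ofFunctor g) (f.obj a) _ h)
      (post_ofFunctor g p q)

theorem post_split (f g : C ⥤ C) {c a a' : C} (k : a ⟶ a') (h : c ⟶ g.obj (f.obj a)) :
    (comp (ofFunctor f) (ofFunctor g)).post k (split f g h) = split f g (h ≫ g.map (f.map k)) := by
  refine Eq.trans ?_ (tpair_eq_split f g (f.map k) h)
  refine congrArg (fun y => tpair (P := ofFunctor f) (Q := ofFunctor g) (f.obj a) y h) ?_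
  exact (post_ofFunctor f k (𝟙 _)).trans (Category.id_comp _)

/-- The profunctor `C(-, t -)` of a comonad `t` is a comonoid in `(prof(C, C), ∘, i)`: the
counit is `h ↦ h ≫ ε`, and the comultiplication is `h ↦ h ≫ δ` followed by the canonical
bijection from `C(c, t(t(a)))` to the coend `∫^b C(b, t(a)) × C(c, t(b))`. -/
@[reducible]
def ofComonad (t : Comonad C) : ComonObj (ofFunctor t.toFunctor) where
  counit := mkHom (Q := unit C) (fun {c a} (h : c ⟶ t.obj a) => h ≫ t.ε.app a)
    (fun _ _ => Category.assoc _ _ _)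
    (fun {c a a'} f (h : c ⟶ t.obj a) => by
      refine Eq.trans (congrArg (fun k => k ≫ t.ε.app a') (post_ofFunctor t.toFunctor f h)) ?_
      refine Eq.trans ?_ (post_ofFunctor (𝟭 C) f (h ≫ t.ε.app a)).symm
      simp only [Functor.id_map, Category.assoc]
      exact congrArg (h ≫ ·) (t.ε.naturality f))
  comul := mkHom (Q := comp (ofFunctor t.toFunctor) (ofFunctor t.toFunctor))
    (fun {c a} (h : c ⟶ t.obj a) => split t.toFunctor t.toFunctor (h ≫ t.δ.app a))
    (fun g h => congrArg (split t.toFunctor t.toFunctor) (Category.assoc g h _))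
    (fun {c a a'} f (h : c ⟶ t.obj a) => by
      refine Eq.trans ?_ (post_split t.toFunctor t.toFunctor f _).symm
      refine congrArg (split t.toFunctor t.toFunctor) ?_
      refine Eq.trans (congrArg (fun k => k ≫ t.δ.app a') (post_ofFunctor t.toFunctor f h)) ?_
      simp)
  counit_comul := by
    ext c a (h : c ⟶ t.obj a)
    have e := tpair_eq_split (𝟭 C) t.toFunctor (𝟙 _ ≫ t.ε.app a) (h ≫ t.δ.app a)
    refine e.trans (congrArg (split (𝟭 C) t.toFunctor) ?_)
    simp
  comul_counit := by
    ext c a (h : c ⟶ t.obj a)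
    have e := tpair_eq_split t.toFunctor (𝟭 C) (𝟙 _) ((h ≫ t.δ.app a) ≫ t.ε.app (t.obj a))
    refine e.trans ((congrArg (split t.toFunctor (𝟭 C)) ?_).trans
      (tpair_eq_split t.toFunctor (𝟭 C) h (𝟙 c)).symm)
    simp
  comul_assoc := by
    ext c a (h : c ⟶ t.obj a)
    refine congrArg (tpair (P := ofFunctor t.toFunctor)
      (Q := comp (ofFunctor t.toFunctor) (ofFunctor t.toFunctor)) (t.obj a) (𝟙 (t.obj a))) ?_
    refine Eq.trans ?_ (tpair_eq_split t.toFunctor t.toFunctor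
      (𝟙 _ ≫ t.δ.app a) (h ≫ t.δ.app a)).symm
    refine congrArg (split t.toFunctor t.toFunctor) ?_
    simp [t.coassoc a]

end EndoProf

/-- Coseparability of a comonad `t` on `C`, regarded as the comonoid `C(-, t -)` in
`(prof(C, C), ∘, i)`. -/
def IsCoseparableInProf {C : Type u} [SmallCategory C] (t : Comonad C) : Prop :=
  letI := EndoProf.ofComonad t
  IsCoseparable (EndoProf.ofFunctor t.toFunctor)

/-! ### Hopf comonads and cointegrals -/

section Hopf

open Functor.LaxMonoidal

variable {C : Type u} [Category.{v} C] [MonoidalCategory C]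

/-- A monoidal comonad: the underlying functor carries a lax monoidal structure `(t₂, t₀)`, and
the comultiplication and the counit are monoidal natural transformations. -/
class MonoidalComonad (t : Comonad C) extends t.toFunctor.LaxMonoidal where
  monoidal_counit : NatTrans.IsMonoidal t.ε
  monoidal_comul : NatTrans.IsMonoidal t.δ

variable (t : Comonad C) [MonoidalComonad t]

/-- The morphism `t₀ : K ⟶ t(K)`. -/
abbrev unitMap : 𝟙_ C ⟶ t.obj (𝟙_ C) := Functor.LaxMonoidal.ε t.toFunctor

/-- The morphism `t₂ : t(X) ⊗ t(Y) ⟶ t(X ⊗ Y)`. -/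
abbrev tensorMap (X Y : C) : t.obj X ⊗ t.obj Y ⟶ t.obj (X ⊗ Y) :=
  Functor.LaxMonoidal.μ t.toFunctor X Y

/-- The left fusion operator `t(X) ⊗ t(Y) ⟶ t(X) ⊗ t(t(Y)) ⟶ t(X ⊗ t(Y))`. -/
def leftFusion (X Y : C) : t.obj X ⊗ t.obj Y ⟶ t.obj (X ⊗ t.obj Y) :=
  t.obj X ◁ t.δ.app Y ≫ tensorMap t X (t.obj Y)

/-- The right fusion operator `t(X) ⊗ t(Y) ⟶ t(t(X)) ⊗ t(Y) ⟶ t(t(X) ⊗ Y)`. -/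
def rightFusion (X Y : C) : t.obj X ⊗ t.obj Y ⟶ t.obj (t.obj X ⊗ Y) :=
  t.δ.app X ▷ t.obj Y ≫ tensorMap t (t.obj X) Y

/-- A monoidal comonad is a Hopf comonad if all its fusion operators are invertible. -/
structure IsHopfComonad : Prop where
  isIso_leftFusion (X Y : C) : IsIso (leftFusion t X Y)
  isIso_rightFusion (X Y : C) : IsIso (rightFusion t X Y)

/-- A morphism `Λ : t(K) ⟶ K` is a normalized left cointegral if `t(Λ) ∘ δ_K = t₀ ∘ Λ` and
`Λ ∘ t₀ = 1`. -/
structure IsNormalizedLeftCointegral (Λ : t.obj (𝟙_ C) ⟶ 𝟙_ C) : Prop where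
  comul_map : t.δ.app (𝟙_ C) ≫ t.map Λ = Λ ≫ unitMap t
  normalized : unitMap t ≫ Λ = 𝟙 (𝟙_ C)

/-- The natural transformation `C(K, -) ⟶ C(t(K), t(-)) ⟶ C(K, t(-))`, `f ↦ t(f) ∘ t₀`. -/
def unitCoaction : coyoneda.obj (op (𝟙_ C)) ⟶ t.toFunctor ⋙ coyoneda.obj (op (𝟙_ C)) where
  app _ := ↾(fun f => unitMap t ≫ t.map f)

/-- A natural transformation `τ : C(K, t(-)) ⟶ C(K, -)` is a normalized right cointegral if it is
a retraction of `f ↦ t(f) ∘ t₀` and `τ_{t(x)}(δ_x ∘ f) = t(τ_x(f)) ∘ t₀` for all objects `x` and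
all `f : K ⟶ t(x)`. -/
structure IsNormalizedRightCointegral
    (τ : t.toFunctor ⋙ coyoneda.obj (op (𝟙_ C)) ⟶ coyoneda.obj (op (𝟙_ C))) : Prop where
  comul_app (x : C) (f : 𝟙_ C ⟶ t.obj x) :
    τ.app (t.obj x) (f ≫ t.δ.app x) = unitMap t ≫ t.map (τ.app x f)
  normalized : unitCoaction t ≫ τ = 𝟙 (coyoneda.obj (op (𝟙_ C)))

end Hopf

end HopfMaschke

/-!
All four conditions are compared with the existence of a natural retraction `π : tt ⟶ t` of the
comultiplication which is compatible with the comultiplication on both sides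
(`IsCoseparability`). Write `K` for the monoidal unit and `A = t(K)`.

For endofunctors this is the definition. For profunctors, the coend `∫^b C(b, f(a)) × C(c, g(b))`
is `C(c, g(f(a)))`, so by the Yoneda lemma every morphism `C(-, f -) ∘ C(-, g -) ⟶ C(-, k -)`
comes from a unique natural transformation `f ⋙ g ⟶ k` (`EndoProf.exists_eq_ofNatTrans`).

From `π` one obtains a left cointegral `t(K) ⟶ tt(K) ⟶ t(K) ⟶ K`, composed of `t(t₀)`, `π` and
`ε`, and a right cointegral `f ↦ t₀ ≫ t(f) ≫ π ≫ ε`. Conversely, the left fusion operator at `K` is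
an isomorphism `t(K) ⊗ t(Y) ≅ tt(Y)`, and a left cointegral `Λ` gives
`π : tt(Y) ≅ t(K) ⊗ t(Y) ⟶ K ⊗ t(Y) ≅ t(Y)`
(`IsNormalizedLeftCointegral.isCoseparability`).

Duality is needed only to pass from a right cointegral `τ` to a left one. Let `A*` be the right
dual of `A`. The right fusion operator turns the coevaluation of `A` into `σ : K ⟶ A ⊗ t(A*)`,
and erasing `A` by the counit gives `s : K ⟶ t(A*)` (`unitAntipode`), the analogue of the
inverse antipode of a Hopf algebra. The left cointegral is the adjunct `A ⟶ K` of `τ(s) : K ⟶ A*`.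
Its cointegral equation follows, through the naturality of `τ`, from an identity between two
morphisms `K ⟶ t(A ⊗ A*)` (`unitAntipode_comul_dualAction`), which expresses that the antipode
reverses the comultiplication. The identity is checked after applying the map
`C(K, t(Y ⊗ A*)) ⟶ C(A, t(Y ⊗ K))` given by the left fusion operator and the evaluation of `A`
(`fusedEvaluation`). This map is injective: multiplying `σ` by the image of `f` recovers `f`
(`fusedCoevaluation_fusedEvaluation`).
-/

namespace HopfMaschke

/-! ### Coseparability on components -/

section Comonad

variable {C : Type u} [Category.{v} C]

/-- A coseparability structure on a comonad `t`, spelled out on components. `comul_map` and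
`comul_app` say that `π` commutes with the coactions of `t` through the inner and through the outer
copy of `t` in `t(t(X))`. -/
structure IsCoseparability (t : Comonad C) (π : t.toFunctor ⋙ t.toFunctor ⟶ t.toFunctor) :
    Prop where
  comul_retract (X : C) : t.δ.app X ≫ π.app X = 𝟙 (t.obj X)
  comul_map (X : C) : π.app X ≫ t.δ.app X = t.map (t.δ.app X) ≫ π.app (t.obj X)
  comul_app (X : C) : π.app X ≫ t.δ.app X = t.δ.app (t.obj X) ≫ t.map (π.app X)

attribute [local instance] endofunctorMonoidalCategory

theorem isCoseparableInCat_iff (t : Comonad C) :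
    IsCoseparableInCat t ↔ ∃ π, IsCoseparability t π := by
  constructor
  · rintro ⟨π, h₁, h₂, h₃⟩
    refine ⟨π, fun X => ?_, fun X => ?_, fun X => ?_⟩
    · exact NatTrans.congr_app h₁ X
    · refine (NatTrans.congr_app h₂ X).trans ?_
      exact congrArg (t.map (t.δ.app X) ≫ ·) (Category.id_comp _)
    · refine (NatTrans.congr_app h₃ X).trans ?_
      exact congrArg (t.δ.app (t.obj X) ≫ ·) (Category.id_comp _)
  · rintro ⟨π, h⟩
    refine ⟨π, ?_, ?_, ?_⟩
    · ext X
      exact h.comul_retract X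
    · ext X
      refine (h.comul_map X).trans ?_
      exact congrArg (t.map (t.δ.app X) ≫ ·) (Category.id_comp _).symm
    · ext X
      refine (h.comul_app X).trans ?_
      exact congrArg (t.δ.app (t.obj X) ≫ ·) (Category.id_comp _).symm

end Comonad

/-! ### Profunctor morphisms induced by natural transformations -/

namespace EndoProf

variable {C : Type u} [SmallCategory C]

/-- The inverse of `split`: the class of `(p, q)` goes to `q ≫ g(p)`. -/
def unsplit (f g : C ⥤ C) {c a : C} (x : (comp (ofFunctor f) (ofFunctor g)).val c a) :
    c ⟶ g.obj (f.obj a) :=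
  tlift (ofFunctor f) (ofFunctor g) (a := a) (c := c) (X := c ⟶ g.obj (f.obj a))
    (fun b (p : b ⟶ f.obj a) (q : c ⟶ g.obj b) => q ≫ g.map p)
    (fun {b b'} k (p : b' ⟶ f.obj a) (q : c ⟶ g.obj b) => by
      refine Eq.trans ?_ (congrArg (· ≫ g.map p) (post_ofFunctor g k q)).symm
      refine (congrArg (q ≫ ·) (g.map_comp k p)).trans ?_
      exact (Category.assoc _ _ _).symm) x

theorem unsplit_tpair (f g : C ⥤ C) {c a b : C} (p : b ⟶ f.obj a) (q : c ⟶ g.obj b) :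
    unsplit f g (tpair (P := ofFunctor f) (Q := ofFunctor g) b p q) = q ≫ g.map p := rfl

theorem split_injective (f g : C ⥤ C) {c a : C} :
    Function.Injective (split f g : (c ⟶ g.obj (f.obj a)) → _) := by
  refine Function.LeftInverse.injective (g := unsplit f g) fun h => ?_
  exact (unsplit_tpair f g (𝟙 (f.obj a)) h).trans (by simp)

/-- The morphism of profunctors `C(-, f -) ∘ C(-, g -) ⟶ C(-, k -)` induced by a natural
transformation `f ⋙ g ⟶ k`. -/
def ofNatTrans {f g k : C ⥤ C} (π : f ⋙ g ⟶ k) :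
    comp (ofFunctor f) (ofFunctor g) ⟶ ofFunctor k :=
  mkHom (fun {_ a} x => unsplit f g x ≫ π.app a)
    (fun {_ _ a} h => tpair_ind fun b (p : b ⟶ f.obj a) (q : _ ⟶ g.obj b) =>
      show ((h ≫ q) ≫ g.map p) ≫ π.app a = h ≫ (q ≫ g.map p) ≫ π.app a by
        simp only [Category.assoc])
    (fun {c a a'} h => tpair_ind fun b (p : b ⟶ f.obj a) (q : c ⟶ g.obj b) => by
      refine (congrArg (fun y => (q ≫ g.map y) ≫ π.app a') (post_ofFunctor f h p)).trans ?_
      refine Eq.trans ?_ (post_ofFunctor k h _).symm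
      have := π.naturality h
      simp only [Functor.comp_map] at this
      change (q ≫ g.map (p ≫ f.map h)) ≫ π.app a' = ((q ≫ g.map p) ≫ π.app a) ≫ k.map h
      simp only [Functor.map_comp, Category.assoc, this])

theorem ev_ofNatTrans {f g k : C ⥤ C} (π : f ⋙ g ⟶ k) {c a b : C}
    (p : b ⟶ f.obj a) (q : c ⟶ g.obj b) :
    ev (ofNatTrans π) (tpair (P := ofFunctor f) (Q := ofFunctor g) b p q) =
      (q ≫ g.map p) ≫ π.app a := rfl

/-- Every morphism of profunctors `C(-, f -) ∘ C(-, g -) ⟶ C(-, k -)` is induced by a natural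
transformation, by the Yoneda lemma. -/
theorem exists_eq_ofNatTrans {f g k : C ⥤ C}
    (φ : comp (ofFunctor f) (ofFunctor g) ⟶ ofFunctor k) : ∃ π : f ⋙ g ⟶ k, φ = ofNatTrans π := by
  have key : ∀ {c a : C} (h : c ⟶ g.obj (f.obj a)),
      ev φ (split f g h) = h ≫ (ev φ (split f g (𝟙 (g.obj (f.obj a)))) :
        g.obj (f.obj a) ⟶ k.obj a) := fun {c a} h => by
    refine Eq.trans ?_ (ev_pre φ h (split f g (𝟙 _)))
    exact congrArg (fun y => ev φ (split f g y)) (Category.comp_id h).symm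
  refine ⟨{ app a := ev φ (split f g (𝟙 (g.obj (f.obj a)))), naturality a a' h := ?_ }, ?_⟩
  · refine (key (g.map (f.map h))).symm.trans ?_
    refine Eq.trans ?_ (post_ofFunctor k h _)
    refine Eq.trans ?_ (ev_post φ h (split f g (𝟙 _)))
    refine congrArg (ev φ) ?_
    refine Eq.trans ?_ (post_split f g h _).symm
    exact congrArg (split f g) (Category.id_comp _).symm
  · refine comp_hom_ext fun c a b p q => ?_
    exact (congrArg (ev φ) (tpair_eq_split f g p q)).trans (key _)

variable (t : Comonad C)

/-- As `split` is injective and every morphism `C(-, t -) ∘ C(-, t -) ⟶ C(-, t -)` comes from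
a natural transformation, the axioms for profunctors are those for endofunctors. -/
theorem isCoseparableInProf_iff : IsCoseparableInProf t ↔ ∃ π, IsCoseparability t π := by
  let T := ofFunctor t.toFunctor
  let d : T ⟶ comp T T := (ofComonad t).comul
  -- The morphisms in the axioms of coseparability for `ofNatTrans π`, evaluated on elements.
  have e₀ : ∀ (π : t.toFunctor ⋙ t.toFunctor ⟶ t.toFunctor) {c a : C} (h : c ⟶ t.obj a),
      ev (d ≫ ofNatTrans π) h = h ≫ t.δ.app a ≫ π.app a := fun π c a h => by
    refine (ev_ofNatTrans π (𝟙 (t.obj a)) (h ≫ t.δ.app a)).trans ?_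
    have e : ((h ≫ t.δ.app a) ≫ t.map (𝟙 (t.obj a))) ≫ π.app a = h ≫ t.δ.app a ≫ π.app a := by
      simp
    exact e
  have e₁ : ∀ (π : t.toFunctor ⋙ t.toFunctor ⟶ t.toFunctor) {c a b : C} (p : b ⟶ t.obj a)
      (q : c ⟶ t.obj b), ev (ofNatTrans π ≫ d) (tpair (P := T) (Q := T) b p q) =
        split t.toFunctor t.toFunctor (((q ≫ t.map p) ≫ π.app a) ≫ t.δ.app a) :=
    fun π c a b p q => rfl
  have e₂ : ∀ (π : t.toFunctor ⋙ t.toFunctor ⟶ t.toFunctor) {c a b : C} (p : b ⟶ t.obj a)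
      (q : c ⟶ t.obj b),
      ev (compMap d (𝟙 T) ≫ (assoc T T T).hom ≫ compMap (𝟙 T) (ofNatTrans π))
        (tpair (P := T) (Q := T) b p q) =
        split t.toFunctor t.toFunctor ((q ≫ t.map (p ≫ t.δ.app a)) ≫ π.app (t.obj a)) :=
    fun π c a b p q => rfl
  have e₃ : ∀ (π : t.toFunctor ⋙ t.toFunctor ⟶ t.toFunctor) {c a b : C} (p : b ⟶ t.obj a)
      (q : c ⟶ t.obj b),
      ev (compMap (𝟙 T) d ≫ (assoc T T T).inv ≫ compMap (ofNatTrans π) (𝟙 T))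
        (tpair (P := T) (Q := T) b p q) =
        split t.toFunctor t.toFunctor
          ((q ≫ t.δ.app b) ≫ t.map ((𝟙 (t.obj b) ≫ t.map p) ≫ π.app a)) :=
    fun π c a b p q => tpair_eq_split t.toFunctor t.toFunctor _ _
  constructor
  · rintro ⟨φ, h₁, h₂, h₃⟩
    obtain ⟨π, rfl⟩ := exists_eq_ofNatTrans φ
    refine ⟨π, fun X => ?_, fun X => ?_, fun X => ?_⟩
    · have := (e₀ π (𝟙 _)).symm.trans (congrArg (fun f => ev f (𝟙 (t.obj X))) h₁)
      exact (Category.id_comp _).symm.trans this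
    · have := split_injective _ _ ((e₁ π (𝟙 (t.obj X)) (𝟙 _)).symm.trans
        ((congrArg (fun f => ev f _) h₂).trans (e₂ π _ _)))
      simpa using this
    · have := split_injective _ _ ((e₁ π (𝟙 (t.obj X)) (𝟙 _)).symm.trans
        ((congrArg (fun f => ev f _) h₃).trans (e₃ π _ _)))
      simpa using this
  · rintro ⟨π, h⟩
    refine ⟨ofNatTrans π, ?_, ?_, ?_⟩
    · ext c a p
      refine (e₀ π p).trans ?_
      exact (congrArg (fun y => p ≫ y) (h.comul_retract a)).trans (Category.comp_id _)
    · refine comp_hom_ext fun c a b (p : b ⟶ t.obj a) (q : c ⟶ t.obj b) =>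
        (e₁ π p q).trans (Eq.trans ?_ (e₂ π p q).symm)
      refine congrArg (split t.toFunctor t.toFunctor) ?_
      have n := h.comul_map a
      simp only [Category.assoc, Functor.map_comp, n]
    · refine comp_hom_ext fun c a b (p : b ⟶ t.obj a) (q : c ⟶ t.obj b) =>
        (e₁ π p q).trans (Eq.trans ?_ (e₃ π p q).symm)
      refine congrArg (split t.toFunctor t.toFunctor) ?_
      have n := h.comul_app a
      have n' := t.δ.naturality p
      dsimp at n'
      simp only [Category.assoc, Category.id_comp, Functor.map_comp, n, reassoc_of% n']

end EndoProf

/-! ### Cointegrals from a coseparability structure -/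

section Hopf

variable {C : Type u} [Category.{v} C] [MonoidalCategory C] (t : Comonad C) [MonoidalComonad t]

theorem unitMap_counit : unitMap t ≫ t.ε.app (𝟙_ C) = 𝟙 (𝟙_ C) :=
  (MonoidalComonad.monoidal_counit (t := t)).unit

theorem unitMap_comul : unitMap t ≫ t.δ.app (𝟙_ C) = unitMap t ≫ t.map (unitMap t) :=
  (MonoidalComonad.monoidal_comul (t := t)).unit

theorem tensorMap_comul (X Y : C) : tensorMap t X Y ≫ t.δ.app (X ⊗ Y) =
    (t.δ.app X ⊗ₘ t.δ.app Y) ≫ tensorMap t (t.obj X) (t.obj Y) ≫ t.map (tensorMap t X Y) :=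
  (MonoidalComonad.monoidal_comul (t := t)).tensor X Y

variable {t} {π : t.toFunctor ⋙ t.toFunctor ⟶ t.toFunctor}

theorem IsCoseparability.isNormalizedLeftCointegral (h : IsCoseparability t π) :
    IsNormalizedLeftCointegral t (t.map (unitMap t) ≫ π.app (𝟙_ C) ≫ t.ε.app (𝟙_ C)) where
  comul_map := by
    have n := t.δ.naturality (unitMap t)
    have n1 := t.ε.naturality (unitMap t)
    have n2 := π.naturality (unitMap t)
    dsimp at n n1 n2
    simp only [Functor.map_comp, Category.assoc]
    rw [← reassoc_of% n, ← reassoc_of% h.comul_app, t.right_counit, ← n1, ← reassoc_of% n2,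
      ← Functor.map_comp_assoc, ← unitMap_comul, Functor.map_comp_assoc,
      ← reassoc_of% h.comul_map, t.left_counit]
  normalized := by
    rw [← reassoc_of% unitMap_comul t, reassoc_of% h.comul_retract, unitMap_counit]

/-- The transformation `f ↦ t₀ ≫ t(f) ≫ π ≫ ε` from `C(K, t -)` to `C(K, -)`. -/
def rightCointegralOf (t : Comonad C) [MonoidalComonad t]
    (π : t.toFunctor ⋙ t.toFunctor ⟶ t.toFunctor) :
    t.toFunctor ⋙ coyoneda.obj (op (𝟙_ C)) ⟶ coyoneda.obj (op (𝟙_ C)) where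
  app X := ↾(fun f : 𝟙_ C ⟶ t.obj X => unitMap t ≫ t.map f ≫ π.app X ≫ t.ε.app X)
  naturality X Y g := by
    ext (f : 𝟙_ C ⟶ t.obj X)
    have n1 := t.ε.naturality g
    have n2 := π.naturality g
    dsimp at n1 n2
    change unitMap t ≫ t.map (f ≫ t.map g) ≫ π.app Y ≫ t.ε.app Y =
      (unitMap t ≫ t.map f ≫ π.app X ≫ t.ε.app X) ≫ g
    simp only [Functor.map_comp, Category.assoc]
    rw [reassoc_of% n2, n1]

theorem IsCoseparability.isNormalizedRightCointegral (h : IsCoseparability t π) :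
    IsNormalizedRightCointegral t (rightCointegralOf t π) where
  comul_app X f := by
    change unitMap t ≫ t.map (f ≫ t.δ.app X) ≫ π.app (t.obj X) ≫ t.ε.app (t.obj X) =
      unitMap t ≫ t.map (unitMap t ≫ t.map f ≫ π.app X ≫ t.ε.app X)
    have n := t.δ.naturality f
    dsimp at n
    simp only [Functor.map_comp, Category.assoc]
    rw [← reassoc_of% h.comul_map, t.left_counit, ← reassoc_of% unitMap_comul t,
      ← reassoc_of% n, ← reassoc_of% h.comul_app, t.right_counit]
  normalized := by
    ext X (f : 𝟙_ C ⟶ X)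
    change unitMap t ≫ t.map (unitMap t ≫ t.map f) ≫ π.app X ≫ t.ε.app X = f
    have n := t.δ.naturality f
    have n1 := t.ε.naturality f
    dsimp at n n1
    simp only [Functor.map_comp, Category.assoc]
    rw [← reassoc_of% unitMap_comul t, ← reassoc_of% n, reassoc_of% h.comul_retract, n1,
      reassoc_of% unitMap_counit t]

end Hopf

/-! ### Coseparability from a left cointegral -/

section Hopf

variable {C : Type u} [Category.{v} C] [MonoidalCategory C] {t : Comonad C}

theorem comul_tensor_comul_comul (X Y : C) :
    t.obj X ◁ t.δ.app Y ≫ (t.δ.app X ⊗ₘ t.δ.app (t.obj Y)) =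
      (t.δ.app X ⊗ₘ t.δ.app Y) ≫ t.obj (t.obj X) ◁ t.map (t.δ.app Y) := by
  have c := t.coassoc Y
  dsimp at c ⊢
  rw [tensorHom_def', tensorHom_def', Category.assoc, ← whisker_exchange,
    ← whiskerLeft_comp_assoc, ← whiskerLeft_comp_assoc, c]

variable [MonoidalComonad t]

open Functor.LaxMonoidal

/-- The fusion operator is a morphism of coalgebras from the tensor product of the cofree
coalgebras `t(X)` and `t(Y)` to the cofree coalgebra `t(X ⊗ t(Y))`. -/
theorem leftFusion_comul (X Y : C) : leftFusion t X Y ≫ t.δ.app (X ⊗ t.obj Y) =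
    (t.δ.app X ⊗ₘ t.δ.app Y) ≫ tensorMap t (t.obj X) (t.obj Y) ≫ t.map (leftFusion t X Y) := by
  simp only [leftFusion, Functor.map_comp, Category.assoc]
  rw [tensorMap_comul, reassoc_of% comul_tensor_comul_comul (t := t)]
  congr 1
  exact μ_natural_right_assoc (F := t.toFunctor) _ _ _

variable (t) in
/-- The left fusion operator at the monoidal unit, `t(K) ⊗ t(Y) ⟶ t(t(Y))`. -/
def unitFusion (Y : C) : t.obj (𝟙_ C) ⊗ t.obj Y ⟶ t.obj (t.obj Y) :=
  leftFusion t (𝟙_ C) Y ≫ t.map (λ_ (t.obj Y)).hom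

theorem unitFusion_naturality {Y Y' : C} (f : Y ⟶ Y') :
    unitFusion t Y ≫ t.map (t.map f) = t.obj (𝟙_ C) ◁ t.map f ≫ unitFusion t Y' := by
  have n := t.δ.naturality f
  dsimp at n
  have m := μ_natural_right t.toFunctor (𝟙_ C) (t.map f)
  simp only [unitFusion, leftFusion, Category.assoc, ← whiskerLeft_comp_assoc, n]
  rw [whiskerLeft_comp_assoc]
  erw [reassoc_of% m]
  rw [← Functor.map_comp, ← Functor.map_comp, leftUnitor_naturality]

theorem unitFusion_comul_right (Y : C) :
    unitFusion t Y ≫ t.map (t.δ.app Y) = t.obj (𝟙_ C) ◁ t.δ.app Y ≫ unitFusion t (t.obj Y) := by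
  have m := μ_natural_right t.toFunctor (𝟙_ C) (t.δ.app Y)
  dsimp at m
  simp only [unitFusion, leftFusion, Category.assoc, ← whiskerLeft_comp_assoc, ← t.coassoc]
  rw [whiskerLeft_comp_assoc]
  erw [reassoc_of% m]
  rw [← Functor.map_comp, ← Functor.map_comp, leftUnitor_naturality]

theorem unitMap_whiskerRight_unitFusion (Y : C) :
    unitMap t ▷ t.obj Y ≫ unitFusion t Y = (λ_ (t.obj Y)).hom ≫ t.δ.app Y := by
  have l := left_unitality t.toFunctor (t.obj Y)
  have n := leftUnitor_naturality (t.δ.app Y)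
  dsimp at l n
  simp only [unitFusion, leftFusion, Category.assoc]
  rw [← whisker_exchange_assoc]
  dsimp
  rw [← n, l]

theorem unitFusion_comul (Y : C) : unitFusion t Y ≫ t.δ.app (t.obj Y) =
    (t.δ.app (𝟙_ C) ⊗ₘ t.δ.app Y) ≫ tensorMap t (t.obj (𝟙_ C)) (t.obj Y) ≫
      t.map (unitFusion t Y) := by
  have n := t.δ.naturality (λ_ (t.obj Y)).hom
  dsimp at n
  simp only [unitFusion, Category.assoc, Functor.map_comp]
  rw [n, reassoc_of% leftFusion_comul (t := t)]

/-- The retraction `t(t(Y)) ≅ t(K) ⊗ t(Y) ⟶ t(Y)` of the comultiplication given by a morphism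
`Λ : t(K) ⟶ K`, where the isomorphism is the inverse of the fusion operator. -/
noncomputable def retractionOf [∀ Y : C, IsIso (unitFusion t Y)] (Λ : t.obj (𝟙_ C) ⟶ 𝟙_ C) :
    t.toFunctor ⋙ t.toFunctor ⟶ t.toFunctor where
  app Y := inv (unitFusion t Y) ≫ Λ ▷ t.obj Y ≫ (λ_ (t.obj Y)).hom
  naturality Y Y' f := by
    dsimp
    rw [← cancel_epi (unitFusion t Y)]
    simp only [IsIso.hom_inv_id_assoc, Category.assoc]
    rw [reassoc_of% unitFusion_naturality (t := t), IsIso.hom_inv_id_assoc,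
      whisker_exchange_assoc, leftUnitor_naturality]

theorem unitFusion_retractionOf [∀ Y : C, IsIso (unitFusion t Y)] (Λ : t.obj (𝟙_ C) ⟶ 𝟙_ C)
    (Y : C) : unitFusion t Y ≫ (retractionOf Λ).app Y = Λ ▷ t.obj Y ≫ (λ_ (t.obj Y)).hom := by
  simp [retractionOf]

/-- The compatibilities with the comultiplication are checked on `t(K) ⊗ t(Y)`, after composition
with the isomorphism `unitFusion`. The cointegral equation enters only in `comul_app`. -/
theorem IsNormalizedLeftCointegral.isCoseparability [∀ Y : C, IsIso (unitFusion t Y)]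
    {Λ : t.obj (𝟙_ C) ⟶ 𝟙_ C} (h : IsNormalizedLeftCointegral t Λ) :
    IsCoseparability t (retractionOf Λ) where
  comul_retract Y := by
    rw [← cancel_epi (λ_ (t.obj Y)).hom, ← reassoc_of% unitMap_whiskerRight_unitFusion (t := t),
      unitFusion_retractionOf, ← comp_whiskerRight_assoc, h.normalized]
    simp
  comul_map Y := by
    have n := leftUnitor_naturality (t.δ.app Y)
    dsimp at n
    rw [← cancel_epi (unitFusion t Y), reassoc_of% unitFusion_retractionOf Λ,
      reassoc_of% unitFusion_comul_right (t := t), unitFusion_retractionOf,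
      whisker_exchange_assoc]
    dsimp
    rw [n]
  comul_app Y := by
    have m := μ_natural_left t.toFunctor Λ (t.obj Y)
    have n := leftUnitor_naturality (t.δ.app Y)
    have l := left_unitality t.toFunctor (t.obj Y)
    have c := h.comul_map
    have e := whisker_exchange Λ (t.δ.app Y)
    dsimp at n l c e
    rw [← cancel_epi (unitFusion t Y), reassoc_of% unitFusion_retractionOf Λ,
      reassoc_of% unitFusion_comul (t := t), ← Functor.map_comp, unitFusion_retractionOf,
      Functor.map_comp, ← reassoc_of% m]
    dsimp
    rw [← n, l, tensorHom_def'_assoc, ← comp_whiskerRight_assoc, c, comp_whiskerRight_assoc,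
      reassoc_of% e]

end Hopf

/-! ### Identities between the left and the right fusion operators -/

section Hopf

open Functor.LaxMonoidal

variable {C : Type u} [Category.{v} C] [MonoidalCategory C] {t : Comonad C} [MonoidalComonad t]

theorem rightFusion_naturality_right (X : C) {Y Y' : C} (f : Y ⟶ Y') :
    t.obj X ◁ t.map f ≫ rightFusion t X Y' = rightFusion t X Y ≫ t.map (t.obj X ◁ f) := by
  have m := μ_natural_right t.toFunctor (t.obj X) f
  simp only [rightFusion, Category.assoc]
  rw [← m, whisker_exchange_assoc]
  rfl

theorem leftFusion_naturality_left {X X' : C} (f : X ⟶ X') (Y : C) :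
    t.map f ▷ t.obj Y ≫ leftFusion t X' Y = leftFusion t X Y ≫ t.map (f ▷ t.obj Y) := by
  have m := μ_natural_left t.toFunctor f (t.obj Y)
  simp only [leftFusion, Category.assoc]
  rw [← m, ← whisker_exchange_assoc]
  rfl

/-- The two ways to fuse `t(X) ⊗ t(Y) ⊗ t(Z)` into `t(t(X) ⊗ Y ⊗ t(Z))` agree. -/
theorem leftFusion_rightFusion (X Y Z : C) :
    t.obj X ◁ leftFusion t Y Z ≫ rightFusion t X (Y ⊗ t.obj Z) =
      (α_ _ _ _).inv ≫ rightFusion t X Y ▷ t.obj Z ≫ leftFusion t (t.obj X ⊗ Y) Z ≫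
        t.map (α_ _ _ _).hom := by
  have m := associativity t.toFunctor (t.obj X) Y (t.obj Z)
  simp only [rightFusion, leftFusion, Category.assoc]
  dsimp at m ⊢
  simp only [comp_whiskerRight, whiskerLeft_comp, Category.assoc]
  rw [← whisker_exchange_assoc (μ t.toFunctor (t.obj X) Y) (t.δ.app Z)]
  dsimp [tensorMap]
  rw [m]
  have e := whisker_exchange_assoc (t.δ.app X) (t.obj Y ◁ t.δ.app Z)
    (t.obj (t.obj X) ◁ μ t.toFunctor Y (t.obj Z) ≫ μ t.toFunctor (t.obj X) (Y ⊗ t.obj Z))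
  dsimp at e
  rw [whisker_exchange_assoc]
  simpa using e

theorem leftFusion_tensorMap (X Y Z : C) :
    leftFusion t X Y ▷ t.obj Z ≫ tensorMap t (X ⊗ t.obj Y) Z =
      (α_ _ _ _).hom ≫ t.obj X ◁ rightFusion t Y Z ≫ tensorMap t X (t.obj Y ⊗ Z) ≫
        t.map (α_ _ _ _).inv := by
  have m := associativity t.toFunctor X (t.obj Y) Z
  rw [← cancel_mono (t.map (α_ X (t.obj Y) Z).hom)]
  simp only [rightFusion, leftFusion, Category.assoc, ← Functor.map_comp, Iso.inv_hom_id]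
  dsimp at m ⊢
  rw [comp_whiskerRight_assoc, m]
  simp

theorem unitMap_whiskerLeft_rightFusion (X : C) :
    t.obj X ◁ unitMap t ≫ rightFusion t X (𝟙_ C) =
      (ρ_ _).hom ≫ t.δ.app X ≫ t.map (ρ_ _).inv := by
  have r := right_unitality t.toFunctor (t.obj X)
  have n := rightUnitor_naturality (t.δ.app X)
  dsimp at r n
  rw [← reassoc_of% n, r]
  simp only [rightFusion, Category.assoc]
  rw [whisker_exchange_assoc, ← Functor.map_comp, Iso.hom_inv_id, t.map_id,
    Category.comp_id]
  rfl

end Hopf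

/-! ### From right to left cointegrals -/

section Hopf

open Functor.LaxMonoidal

variable {C : Type u} [Category.{v} C] [MonoidalCategory C]

/-- The interchange law for two morphisms out of the monoidal unit. -/
theorem tensor_states {B D Z : C} (a : 𝟙_ C ⟶ B ⊗ D) (f : 𝟙_ C ⟶ Z) :
    a ≫ (λ_ B).inv ▷ D ≫ f ▷ B ▷ D ≫ (α_ Z B D).hom = f ≫ (ρ_ Z).inv ≫ Z ◁ a := by
  rw [rightUnitor_inv_naturality_assoc, ← whisker_exchange, ← unitors_inv_equal,
    ← leftUnitor_inv_naturality_assoc]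
  simp

variable {t : Comonad C}

/-- The naturality of a transformation `C(K, t -) ⟶ C(K, -)`, on elements. -/
theorem app_comp_map (τ : t.toFunctor ⋙ coyoneda.obj (op (𝟙_ C)) ⟶ coyoneda.obj (op (𝟙_ C)))
    {X Y : C} (f : 𝟙_ C ⟶ t.obj X) (g : X ⟶ Y) :
    (τ.app Y (f ≫ t.map g) : 𝟙_ C ⟶ Y) = (τ.app X f : 𝟙_ C ⟶ X) ≫ g :=
  NatTrans.naturality_apply τ g f

variable [MonoidalComonad t]

theorem unitMap_whiskerRight_leftFusion (Y : C) :
    unitMap t ▷ t.obj Y ≫ leftFusion t (𝟙_ C) Y =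
      (λ_ (t.obj Y)).hom ≫ t.δ.app Y ≫ t.map (λ_ (t.obj Y)).inv := by
  have := unitMap_whiskerRight_unitFusion (t := t) Y
  rw [unitFusion, ← Category.assoc, ← t.mapIso_hom, ← Iso.eq_comp_inv] at this
  simpa using this

theorem comul_whiskerRight_leftFusion (X Y : C) :
    t.δ.app X ▷ t.obj Y ≫ leftFusion t (t.obj X) Y ≫ t.map (leftFusion t X Y) =
      leftFusion t X Y ≫ t.δ.app (X ⊗ t.obj Y) := by
  rw [leftFusion_comul, tensorHom_def_assoc]
  simp [leftFusion]

variable [HasRightDual (t.obj (𝟙_ C))]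

variable (t) in
/-- For `A = t(K)`, the morphism `t(A*) ⟶ A ⊗ A*` which corresponds to the composite
`t(A*) ⊗ A ⟶ t(A* ⊗ A) ⟶ t(K) = A` of the left fusion operator and the evaluation. -/
noncomputable def dualAction : t.obj (t.obj (𝟙_ C))ᘁ ⟶ t.obj (𝟙_ C) ⊗ (t.obj (𝟙_ C))ᘁ :=
  tensorRightHomEquiv _ (t.obj (𝟙_ C)) (t.obj (𝟙_ C))ᘁ _ (leftFusion t (t.obj (𝟙_ C))ᘁ (𝟙_ C) ≫
    t.map (ε_ (t.obj (𝟙_ C)) (t.obj (𝟙_ C))ᘁ))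

theorem dualAction_evaluation :
    dualAction t ▷ t.obj (𝟙_ C) ≫ (α_ _ _ _).hom ≫
      t.obj (𝟙_ C) ◁ ε_ (t.obj (𝟙_ C)) (t.obj (𝟙_ C))ᘁ =
    leftFusion t (t.obj (𝟙_ C))ᘁ (𝟙_ C) ≫ t.map (ε_ (t.obj (𝟙_ C)) (t.obj (𝟙_ C))ᘁ) ≫
      (ρ_ (t.obj (𝟙_ C))).inv := by
  have h := (tensorRightHomEquiv _ (t.obj (𝟙_ C)) (t.obj (𝟙_ C))ᘁ _).symm_apply_apply
    (leftFusion t (t.obj (𝟙_ C))ᘁ (𝟙_ C) ≫ t.map (ε_ (t.obj (𝟙_ C)) (t.obj (𝟙_ C))ᘁ))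
  rw [← reassoc_of% h]
  simp [dualAction, tensorRightHomEquiv, -right_unitality]

theorem unitMap_whiskerRight_evaluation :
    ((λ_ _).inv ≫ unitMap t ▷ (t.obj (𝟙_ C))ᘁ) ▷ t.obj (𝟙_ C) ≫ (α_ _ _ _).hom ≫
      t.obj (𝟙_ C) ◁ ε_ (t.obj (𝟙_ C)) (t.obj (𝟙_ C))ᘁ =
      ε_ (t.obj (𝟙_ C)) (t.obj (𝟙_ C))ᘁ ≫ unitMap t ≫ (ρ_ _).inv := by
  rw [rightUnitor_inv_naturality, ← unitors_inv_equal, leftUnitor_inv_naturality_assoc,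
    whisker_exchange]
  simp

variable [∀ Y : C, IsIso (rightFusion t (𝟙_ C) Y)]

variable (t) in
/-- The image of the coevaluation `K ⟶ A ⊗ A*`, `A = t(K)`, under
`C(K, -) ⟶ C(K, t(-))` and the inverse of the fusion operator `t(K) ⊗ t(A*) ⟶ t(A ⊗ A*)`. -/
noncomputable def fusedCoevaluation :
    𝟙_ C ⟶ t.obj (𝟙_ C) ⊗ t.obj (t.obj (𝟙_ C))ᘁ :=
  unitMap t ≫ t.map (η_ (t.obj (𝟙_ C)) (t.obj (𝟙_ C))ᘁ) ≫
    inv (rightFusion t (𝟙_ C) (t.obj (𝟙_ C))ᘁ)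

theorem fusedCoevaluation_rightFusion :
    fusedCoevaluation t ≫ rightFusion t (𝟙_ C) (t.obj (𝟙_ C))ᘁ =
      unitMap t ≫ t.map (η_ (t.obj (𝟙_ C)) (t.obj (𝟙_ C))ᘁ) := by
  simp [fusedCoevaluation]

/-- For the comonad `H ⊗ -` of a Hopf algebra this reads `h₃ ⊗ S⁻¹(h₂) h₁ = h ⊗ 1`. -/
theorem fusedCoevaluation_leftFusion :
    (λ_ (t.obj (𝟙_ C))).inv ≫ fusedCoevaluation t ▷ t.obj (𝟙_ C) ≫ (α_ _ _ _).hom ≫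
      t.obj (𝟙_ C) ◁ (leftFusion t (t.obj (𝟙_ C))ᘁ (𝟙_ C) ≫
        t.map (ε_ (t.obj (𝟙_ C)) (t.obj (𝟙_ C))ᘁ)) =
    (ρ_ (t.obj (𝟙_ C))).inv ≫ t.obj (𝟙_ C) ◁ unitMap t := by
  -- Both sides become `δ_K`, up to a unit isomorphism, after the fusion operator.
  rw [← cancel_mono (rightFusion t (𝟙_ C) (𝟙_ C))]
  simp only [Category.assoc, whiskerLeft_comp]
  rw [rightFusion_naturality_right, reassoc_of% leftFusion_rightFusion (t := t),
    Iso.hom_inv_id_assoc, ← comp_whiskerRight_assoc, fusedCoevaluation_rightFusion,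
    comp_whiskerRight_assoc, reassoc_of% leftFusion_naturality_left (t := t),
    reassoc_of% unitMap_whiskerRight_leftFusion (t := t), unitMap_whiskerLeft_rightFusion,
    ← Functor.map_comp, ← Functor.map_comp, ← Functor.map_comp,
    ExactPairing.evaluation_coevaluation]
  simp

variable (t) in
/-- The antipode of `t` at the monoidal unit, `K ⟶ t(t(K)*)`. For the comonad `H ⊗ -` of a Hopf
algebra it is the tensor of the inverse antipode, as the right dual is used. -/
noncomputable def unitAntipode : 𝟙_ C ⟶ t.obj (t.obj (𝟙_ C))ᘁ :=
  fusedCoevaluation t ≫ t.ε.app (𝟙_ C) ▷ _ ≫ (λ_ _).hom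

/-- The antipode axiom, which for a Hopf algebra reads `S⁻¹(h₂) h₁ = ε(h) 1`. -/
theorem unitAntipode_leftFusion :
    (λ_ (t.obj (𝟙_ C))).inv ≫ unitAntipode t ▷ t.obj (𝟙_ C) ≫
      leftFusion t (t.obj (𝟙_ C))ᘁ (𝟙_ C) ≫ t.map (ε_ (t.obj (𝟙_ C)) (t.obj (𝟙_ C))ᘁ) =
    t.ε.app (𝟙_ C) ≫ unitMap t := by
  have h := congrArg (· ≫ t.ε.app (𝟙_ C) ▷ _ ≫ (λ_ _).hom) (fusedCoevaluation_leftFusion (t := t))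
  set g := leftFusion t (t.obj (𝟙_ C))ᘁ (𝟙_ C) ≫ t.map (ε_ (t.obj (𝟙_ C)) (t.obj (𝟙_ C))ᘁ)
  have l := leftUnitor_naturality g
  have r := rightUnitor_naturality (t.ε.app (𝟙_ C))
  have l' := leftUnitor_naturality (unitMap t)
  dsimp at l r l'
  simp only [Category.assoc, whisker_exchange_assoc] at h
  dsimp at h
  rw [l, l', unitors_equal, reassoc_of% r, Iso.inv_hom_id_assoc] at h
  simpa [unitAntipode, -left_unitality] using h

variable (t) in
/-- The map `C(K, t(Y ⊗ A*)) ⟶ C(A, t(Y ⊗ K))`, `A = t(K)`, given by the left fusion operator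
and the evaluation of `A`. -/
def fusedEvaluation (Y : C) (f : 𝟙_ C ⟶ t.obj (Y ⊗ (t.obj (𝟙_ C))ᘁ)) :
    t.obj (𝟙_ C) ⟶ t.obj (Y ⊗ 𝟙_ C) :=
  (λ_ _).inv ≫ f ▷ t.obj (𝟙_ C) ≫ leftFusion t _ (𝟙_ C) ≫
    t.map ((α_ _ _ _).hom ≫ Y ◁ ε_ (t.obj (𝟙_ C)) (t.obj (𝟙_ C))ᘁ)

/-- The morphism `f` is recovered from its image under `fusedEvaluation`, by the triangle identity
for `A` and `A*`. -/
theorem fusedCoevaluation_fusedEvaluation (Y : C) (f : 𝟙_ C ⟶ t.obj (Y ⊗ (t.obj (𝟙_ C))ᘁ)) :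
    fusedCoevaluation t ≫ fusedEvaluation t Y f ▷ _ ≫ tensorMap t _ _ =
      f ≫ t.map ((ρ_ Y).inv ▷ _) := by
  have m := μ_natural_left t.toFunctor ((α_ Y _ _).hom ≫
    Y ◁ ε_ (t.obj (𝟙_ C)) (t.obj (𝟙_ C))ᘁ) (t.obj (𝟙_ C))ᘁ
  have m' := μ_natural_right t.toFunctor (Y ⊗ (t.obj (𝟙_ C))ᘁ) (η_ (t.obj (𝟙_ C)) (t.obj (𝟙_ C))ᘁ)
  have r := right_unitality_inv t.toFunctor (Y ⊗ (t.obj (𝟙_ C))ᘁ)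
  have z : (ρ_ (Y ⊗ (t.obj (𝟙_ C))ᘁ)).inv ≫
      (Y ⊗ (t.obj (𝟙_ C))ᘁ) ◁ η_ (t.obj (𝟙_ C)) (t.obj (𝟙_ C))ᘁ ≫ (α_ _ _ _).inv ≫
      ((α_ _ _ _).hom ≫ Y ◁ ε_ (t.obj (𝟙_ C)) (t.obj (𝟙_ C))ᘁ) ▷ _ = (ρ_ Y).inv ▷ _ := by
    have c := congrArg (fun g => Y ◁ ((ρ_ _).inv ≫ g) ≫ (α_ _ _ _).inv)
      (ExactPairing.coevaluation_evaluation (t.obj (𝟙_ C)) (t.obj (𝟙_ C))ᘁ)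
    refine Eq.trans ?_ (c.trans ?_) <;> monoidal
  rw [← z]
  simp only [fusedEvaluation, comp_whiskerRight, Category.assoc]
  rw [comp_whiskerRight] at m
  rw [m]
  erw [reassoc_of% leftFusion_tensorMap (t := t)]
  have e : fusedCoevaluation t ≫ (λ_ (t.obj (𝟙_ C))).inv ▷ _ ≫ f ▷ t.obj (𝟙_ C) ▷ _ ≫
      (α_ _ _ _).hom ≫ _ ◁ rightFusion t (𝟙_ C) (t.obj (𝟙_ C))ᘁ =
      f ≫ (ρ_ _).inv ≫ _ ◁ (unitMap t ≫ t.map (η_ (t.obj (𝟙_ C)) (t.obj (𝟙_ C))ᘁ)) := by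
    rw [← fusedCoevaluation_rightFusion, reassoc_of% tensor_states, whiskerLeft_comp]
  rw [reassoc_of% e]
  simp only [whiskerLeft_comp, Category.assoc, Functor.map_comp]
  rw [reassoc_of% m', reassoc_of% r]

theorem fusedEvaluation_injective (Y : C) : Function.Injective (fusedEvaluation t Y) := by
  intro f g h
  have e := fusedCoevaluation_fusedEvaluation Y f
  rw [h, fusedCoevaluation_fusedEvaluation] at e
  exact ((cancel_mono _).1 e).symm

/-- The antipode reverses the comultiplication: for the comonad `H ⊗ -` of a Hopf
algebra it equates the tensors of the maps `h ↦ S⁻¹(h₃) ⊗ S⁻¹(h₂) h₁` and `h ↦ S⁻¹(h) ⊗ 1`. -/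
theorem unitAntipode_comul_dualAction :
    unitAntipode t ≫ t.δ.app _ ≫ t.map (dualAction t) =
      unitAntipode t ≫ t.map ((λ_ _).inv ≫ unitMap t ▷ (t.obj (𝟙_ C))ᘁ) := by
  apply fusedEvaluation_injective
  have n := t.δ.naturality (ε_ (t.obj (𝟙_ C)) (t.obj (𝟙_ C))ᘁ)
  dsimp at n
  have z := unitMap_whiskerRight_evaluation (t := t)
  -- By the antipode axiom, both sides are sent to `ε ≫ t₀ ≫ δ`, up to a unit isomorphism.
  trans t.ε.app (𝟙_ C) ≫ unitMap t ≫ t.δ.app (𝟙_ C) ≫ t.map (ρ_ (t.obj (𝟙_ C))).inv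
  · rw [← reassoc_of% unitAntipode_leftFusion (t := t), reassoc_of% n,
      ← reassoc_of% comul_whiskerRight_leftFusion (t := t)]
    simp only [fusedEvaluation, comp_whiskerRight, Category.assoc]
    rw [reassoc_of% leftFusion_naturality_left (t := t), ← Functor.map_comp, dualAction_evaluation]
    simp only [Functor.map_comp]
  · rw [fusedEvaluation, comp_whiskerRight_assoc, reassoc_of% leftFusion_naturality_left (t := t),
      ← Functor.map_comp, z, Functor.map_comp, reassoc_of% unitAntipode_leftFusion (t := t),
      Functor.map_comp, reassoc_of% unitMap_comul t]

/-- The morphism `t(K) ⟶ K` adjunct to `τ(s) : K ⟶ t(K)*`, where `s : K ⟶ t(t(K)*)` is the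
antipode. -/
noncomputable def leftCointegralOf
    (τ : t.toFunctor ⋙ coyoneda.obj (op (𝟙_ C)) ⟶ coyoneda.obj (op (𝟙_ C))) :
    t.obj (𝟙_ C) ⟶ 𝟙_ C :=
  (λ_ _).inv ≫ (τ.app _ (unitAntipode t) : 𝟙_ C ⟶ (t.obj (𝟙_ C))ᘁ) ▷ t.obj (𝟙_ C) ≫
    ε_ (t.obj (𝟙_ C)) (t.obj (𝟙_ C))ᘁ

/-- The cointegral equation is the adjunct of the image under `τ` of
`unitAntipode_comul_dualAction`. -/
theorem IsNormalizedRightCointegral.isNormalizedLeftCointegral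
    {τ : t.toFunctor ⋙ coyoneda.obj (op (𝟙_ C)) ⟶ coyoneda.obj (op (𝟙_ C))}
    (h : IsNormalizedRightCointegral t τ) :
    IsNormalizedLeftCointegral t (leftCointegralOf τ) where
  comul_map := by
    have k := h.comul_app _ (unitAntipode t)
    have k' := congrArg (fun f => (τ.app _ f : 𝟙_ C ⟶ _)) (unitAntipode_comul_dualAction (t := t))
    dsimp only at k'
    rw [← Category.assoc, app_comp_map, app_comp_map, k] at k'
    have q := congrArg (fun f => (λ_ _).inv ≫ f ▷ t.obj (𝟙_ C) ≫ (α_ _ _ _).hom ≫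
      t.obj (𝟙_ C) ◁ ε_ (t.obj (𝟙_ C)) (t.obj (𝟙_ C))ᘁ ≫ (ρ_ _).hom) k'
    have z := reassoc_of% unitMap_whiskerRight_evaluation (t := t)
    have y := reassoc_of% dualAction_evaluation (t := t)
    simp only [comp_whiskerRight _ ((λ_ _).inv ≫ _),
      Category.assoc, z, Iso.inv_hom_id, Category.comp_id] at q
    rw [leftCointegralOf]
    simp only [Category.assoc]
    rw [← q, comp_whiskerRight_assoc, comp_whiskerRight_assoc, y, Iso.inv_hom_id,
      Category.comp_id, reassoc_of% leftFusion_naturality_left (t := t),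
      reassoc_of% unitMap_whiskerRight_leftFusion (t := t), Iso.inv_hom_id_assoc]
    simp only [Functor.map_comp]
  normalized := by
    have k : (τ.app _ (unitMap t) : 𝟙_ C ⟶ _) = 𝟙 _ := by
      have := congrArg (fun f => (f.app (𝟙_ C) (𝟙 (𝟙_ C)) : 𝟙_ C ⟶ _)) h.normalized
      change (τ.app _ (unitMap t ≫ t.map (𝟙 _)) : 𝟙_ C ⟶ _) = 𝟙 _ at this
      rwa [t.map_id, Category.comp_id] at this
    -- The dual of `t₀` sends the antipode to `t₀`.
    have s : unitAntipode t ≫ t.map ((ρ_ _).inv ≫ (t.obj (𝟙_ C))ᘁ ◁ unitMap t ≫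
        ε_ (t.obj (𝟙_ C)) (t.obj (𝟙_ C))ᘁ) = unitMap t := by
      have p := congrArg (unitMap t ≫ ·) (unitAntipode_leftFusion (t := t))
      have m := μ_natural_right t.toFunctor (t.obj (𝟙_ C))ᘁ (unitMap t)
      have r := right_unitality_inv t.toFunctor (t.obj (𝟙_ C))ᘁ
      rw [reassoc_of% unitMap_counit t, leftUnitor_inv_naturality_assoc,
        whisker_exchange_assoc, leftFusion, Category.assoc, ← whiskerLeft_comp_assoc,
        unitMap_comul, whiskerLeft_comp_assoc, reassoc_of% m, unitors_inv_equal,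
        ← rightUnitor_inv_naturality_assoc, reassoc_of% r] at p
      simpa only [Functor.map_comp] using p
    rw [← s, app_comp_map] at k
    rw [← k, leftCointegralOf, leftUnitor_inv_naturality_assoc, whisker_exchange_assoc,
      unitors_inv_equal, ← rightUnitor_inv_naturality_assoc]

end Hopf

end HopfMaschke

theorem mainTheorem10 {C : Type u} [SmallCategory C] [MonoidalCategory C] [RigidCategory C]
    (t : Comonad C) [HopfMaschke.MonoidalComonad t] (ht : HopfMaschke.IsHopfComonad t) :
    List.TFAE [
      HopfMaschke.IsCoseparableInCat t,
      HopfMaschke.IsCoseparableInProf t,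
      ∃ Λ : t.obj (𝟙_ C) ⟶ 𝟙_ C, HopfMaschke.IsNormalizedLeftCointegral t Λ,
      ∃ τ : t.toFunctor ⋙ coyoneda.obj (op (𝟙_ C)) ⟶ coyoneda.obj (op (𝟙_ C)),
        HopfMaschke.IsNormalizedRightCointegral t τ] := by
  have := ht.isIso_rightFusion (𝟙_ C)
  have : ∀ Y : C, IsIso (HopfMaschke.unitFusion t Y) := fun Y => by
    have := ht.isIso_leftFusion (𝟙_ C) Y
    unfold HopfMaschke.unitFusion
    infer_instance
  tfae_have 1 ↔ 2 := (HopfMaschke.isCoseparableInCat_iff t).trans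
    (HopfMaschke.EndoProf.isCoseparableInProf_iff t).symm
  tfae_have 1 → 4 := fun h => by
    obtain ⟨π, hπ⟩ := (HopfMaschke.isCoseparableInCat_iff t).1 h
    exact ⟨_, hπ.isNormalizedRightCointegral⟩
  tfae_have 1 → 3 := fun h => by
    obtain ⟨π, hπ⟩ := (HopfMaschke.isCoseparableInCat_iff t).1 h
    exact ⟨_, hπ.isNormalizedLeftCointegral⟩
  tfae_have 4 → 3 := fun ⟨_, h⟩ => ⟨_, h.isNormalizedLeftCointegral⟩
  tfae_have 3 → 1 := fun ⟨_, h⟩ =>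
    (HopfMaschke.isCoseparableInCat_iff t).2 ⟨_, h.isCoseparability⟩
  tfae_finish
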